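/- All Hilbert spaces are finite-dimensional; a state is a positive semidefinite operator of unit trace, and $F(\rho,\sigma)=\left(\operatorname{Tr}\sqrt{\sqrt{\sigma}\,\rho\,\sqrt{\sigma}}\right)^2$ is the fidelity. Let $k\ge 1$ be an integer and $\varepsilon\in[0,1-\frac{1}{k^2}]$. Let $A,B$ be $k$-dimensional systems with computational bases $\{|i\rangle\}_{i=0}^{k-1}$, let $A',B'$ be arbitrary systems, and let $\Phi^k_{AB}=\frac1k\sum_{i,j=0}^{k-1}|i\rangle\!\langle j|_A\otimes|i\rangle\!\langle j|_B$ be the maximally entangled state. Let $V_{ABA'B'}=\sum_{i=0}^{k-1}|i\rangle\!\langle i|_A\otimes I_B\otimes U^i_{A'B'}$ be a twisting unitary, where each $U^i_{A'B'}$ is unitary, let $\tau_{A'B'}$ be a state, and let $$\gamma^k_{ABA'B'}=V_{ABA'B'}\left(\Phi^k_{AB}\otimes\tau_{A'B'}\right)V_{ABA'B'}^\dagger$$ be the corresponding private state. Let $$\Pi^\gamma_{ABA'B'}=V_{ABA'B'}\left(\Phi^k_{AB}\otimes I_{A'B'}\right)V_{ABA'B'}^\dagger$$ be the corresponding $\gamma^k$-privacy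 test. Let $\sigma_{ABA'B'}$ be a state with $F(\sigma_{ABA'B'},\gamma^k_{ABA'B'})\ge 1-\varepsilon$. Let $E$ be a copy of $B$ and $E'$ a copy of $B'$, and let $$\mathcal F(\sigma_{ABA'B'})=\left\{\operatorname{Tr}_{BB'}[\omega_{ABA'B'EE'}] : \omega_{ABA'B'EE'}\text{ is a state with }\operatorname{Tr}_{EE'}[\omega_{ABA'B'EE'}]=\sigma_{ABA'B'}\right\}.$$ Then every $\omega_{AEA'E'}\in\mathcal F(\sigma_{ABA'B'})$ satisfies $$\operatorname{Tr}\left[\Pi^\gamma_{AEA'E'}\,\omega_{AEA'E'}\right]\le\varsigma(\varepsilon,k):=\varepsilon+\frac{1-2\varepsilon}{k^2}+\frac{2\sqrt{(k^2-1)\,\varepsilon(1-\varepsilon)}}{k^2}.$$ -/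

import Mathlib

open scoped Kronecker MatrixOrder ComplexOrder

noncomputable section

namespace PrivacyTest

/-- A quantum state on the Hilbert space with (finite) orthonormal basis `ι`: a positive
semidefinite operator with unit trace. -/
structure IsState {ι : Type*} [Fintype ι] (ρ : Matrix ι ι ℂ) : Prop where
  posSemidef : ρ.PosSemidef
  trace_eq_one : ρ.trace = 1

/-- The fidelity `F(ρ, σ) = (Tr √(√σ ρ √σ))²`. -/
def fidelity {ι : Type*} [Fintype ι] [DecidableEq ι] (ρ σ : Matrix ι ι ℂ) : ℝ :=
  (Matrix.trace (CFC.sqrt (CFC.sqrt σ * ρ * CFC.sqrt σ))).re ^ 2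

/-! ### Extensions and free states -/

/-- `Tr_E` of an operator on `A ⊗ B ⊗ E`. -/
def traceE {α β η : Type*} [Fintype η] (ω : Matrix (α × β × η) (α × β × η) ℂ) :
    Matrix (α × β) (α × β) ℂ :=
  Matrix.of fun p q => ∑ e, ω (p.1, p.2, e) (q.1, q.2, e)

/-- `Tr_B` of an operator on `A ⊗ B ⊗ E`. -/
def traceB {α β η : Type*} [Fintype β] (ω : Matrix (α × β × η) (α × β × η) ℂ) :
    Matrix (α × η) (α × η) ℂ :=
  Matrix.of fun p q => ∑ b, ω (p.1, b, p.2) (q.1, b, q.2)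

/-- `Ext(ρ_AB)`: the states on `A ⊗ B ⊗ E`, with `E` a copy of `B`, whose marginal on `A ⊗ B`
is `ρ_AB`. -/
def Ext {α β : Type*} [Fintype α] [Fintype β] (ρ : Matrix (α × β) (α × β) ℂ) :
    Set (Matrix (α × β × β) (α × β × β) ℂ) :=
  {ω | IsState ω ∧ traceE ω = ρ}

/-- The free states `F(ρ_AB) = {Tr_B ω_ABE : ω_ABE ∈ Ext(ρ_AB)}`. -/
def freeStates {α β : Type*} [Fintype α] [Fintype β] (ρ : Matrix (α × β) (α × β) ℂ) :
    Set (Matrix (α × β) (α × β) ℂ) :=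
  traceB '' Ext ρ

/-! ### Private states and the privacy test

The key systems `A`, `B` have the computational basis `Fin k`; the shield systems `A'`, `B'` have
bases `s`, `t`. -/

/-- The maximally entangled state vector `k^{-1/2} ∑ i, |i⟩|i⟩`. -/
def maxEntVec (k : ℕ) : Fin k × Fin k → ℂ :=
  fun p => if p.1 = p.2 then ((1 / Real.sqrt k : ℝ) : ℂ) else 0

/-- The maximally entangled state `Φ^k = |Φ^k⟩⟨Φ^k|`. -/
def maxEnt (k : ℕ) : Matrix (Fin k × Fin k) (Fin k × Fin k) ℂ :=
  Matrix.vecMulVec (maxEntVec k) (star (maxEntVec k))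

variable {k : ℕ} {s t : Type*} [Fintype s] [DecidableEq s] [Fintype t] [DecidableEq t]

/-- The twisting unitary `V = ∑ i, |i⟩⟨i|_A ⊗ I_B ⊗ U^i_{A'B'}`. -/
def twist (U : Fin k → Matrix.unitaryGroup (s × t) ℂ) :
    Matrix ((Fin k × Fin k) × (s × t)) ((Fin k × Fin k) × (s × t)) ℂ :=
  ∑ i, (Matrix.single i i (1 : ℂ) ⊗ₖ (1 : Matrix (Fin k) (Fin k) ℂ)) ⊗ₖ
    (U i : Matrix (s × t) (s × t) ℂ)

/-- Rearranging the tensor factors `(A B)(A' B')` as `(A A')(B B')`, so that Alice holds the first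
factor and Bob the second. -/
def regroup (M : Matrix ((Fin k × Fin k) × (s × t)) ((Fin k × Fin k) × (s × t)) ℂ) :
    Matrix ((Fin k × s) × (Fin k × t)) ((Fin k × s) × (Fin k × t)) ℂ :=
  Matrix.reindex (Equiv.prodProdProdComm (Fin k) (Fin k) s t)
    (Equiv.prodProdProdComm (Fin k) (Fin k) s t) M

/-- The operator `V (Φ^k ⊗ τ) V†`, for `τ` a state on `A' ⊗ B'` the private state with twisting
unitary `V` and shield state `τ`. -/
def privateState (U : Fin k → Matrix.unitaryGroup (s × t) ℂ) (τ : Matrix (s × t) (s × t) ℂ) :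
    Matrix ((Fin k × s) × (Fin k × t)) ((Fin k × s) × (Fin k × t)) ℂ :=
  regroup (twist U * (maxEnt k ⊗ₖ τ) * (twist U).conjTranspose)

/-- The passing element `Π^γ = V (Φ^k ⊗ I) V†` of the privacy test. -/
def privacyTest (U : Fin k → Matrix.unitaryGroup (s × t) ℂ) :
    Matrix ((Fin k × s) × (Fin k × t)) ((Fin k × s) × (Fin k × t)) ℂ :=
  regroup (twist U * (maxEnt k ⊗ₖ (1 : Matrix (s × t) (s × t) ℂ)) * (twist U).conjTranspose)

/-- `ς(ε, k) = ε + (1 - 2ε)/k² + 2√((k² - 1)ε(1 - ε))/k²`. -/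
def varsigma (ε : ℝ) (k : ℕ) : ℝ :=
  ε + (1 - 2 * ε) / (k : ℝ) ^ 2 +
    2 * Real.sqrt (((k : ℝ) ^ 2 - 1) * ε * (1 - ε)) / (k : ℝ) ^ 2

end PrivacyTest

end

open scoped Kronecker MatrixOrder ComplexOrder
open Matrix

namespace PrivacyTest

/-! ### The positive semidefinite trace form of a state. -/

section TraceForm

variable {n : Type*} [Fintype n]

/-! On an extension Ω of σ, let P and Q be the tests on `ABA'B'` and `AEA'E'`, each tensored with
the identity. Both are projections `K Kᴴ` with `K` an isometry, and unitarity of the `U i` gives QPQ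
= k⁻²Q (`shieldIsometry_overlap`): the two ranges meet at a constant angle of cosine 1/k.

Let p, q be the probabilities that Ω passes P, Q. As γ is supported on its test, p ≥ F(σ, γ) ≥ 1 - ε
(`fidelity_le_re_trace_projection`). Splitting Q = QP + Q(1 - P) and applying Cauchy–Schwarz to each
term gives √q ≤ (1/k)√p + √(1 - 1/k²)√(1 - p) (`re_trace_le_varsigma`). The right side is the cosine
of a difference of angles, decreasing in p once p ≥ 1/k². Since 1 - ε ≥ 1/k², the worst case is p =
1 - ε, where its square is ς(ε, k). -/

lemma re_trace_conjTranspose_mul_mul_nonneg {ω : Matrix n n ℂ} (hω : ω.PosSemidef)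
    (M : Matrix n n ℂ) : 0 ≤ (Mᴴ * M * ω).trace.re := by
  have h := (hω.mul_mul_conjTranspose_same M).trace_nonneg
  have e : (Mᴴ * M * ω).trace = (M * ω * Mᴴ).trace := by
    rw [Matrix.mul_assoc, Matrix.trace_mul_comm]
  rw [e]
  exact (Complex.nonneg_iff.mp h).1

/-- Cauchy–Schwarz for the positive semidefinite form `(M, N) ↦ Re Tr[M† N ω]`. -/
lemma re_trace_cauchy_schwarz {ω : Matrix n n ℂ} (hω : ω.PosSemidef) (M N : Matrix n n ℂ) :
    (Mᴴ * N * ω).trace.re ^ 2 ≤ (Mᴴ * M * ω).trace.re * (Nᴴ * N * ω).trace.re := by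
  have hsymm : (Nᴴ * M * ω).trace.re = (Mᴴ * N * ω).trace.re := by
    have h : (Mᴴ * N * ω)ᴴ = ω * (Nᴴ * M) := by
      simp [Matrix.conjTranspose_mul, hω.isHermitian.eq]
    have h2 := Matrix.trace_conjTranspose (Mᴴ * N * ω)
    rw [h, Matrix.trace_mul_comm] at h2
    rw [h2]
    simp
  have key : ∀ x : ℝ, 0 ≤ (Nᴴ * N * ω).trace.re * (x * x) + 2 * (Mᴴ * N * ω).trace.re * x
      + (Mᴴ * M * ω).trace.re := by
    intro x
    have h := re_trace_conjTranspose_mul_mul_nonneg hω (M + (x : ℂ) • N)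
    have e : (M + (x : ℂ) • N)ᴴ * (M + (x : ℂ) • N) * ω =
        Mᴴ * M * ω + (x : ℂ) • (Mᴴ * N * ω) + (x : ℂ) • (Nᴴ * M * ω)
          + ((x * x : ℝ) : ℂ) • (Nᴴ * N * ω) := by
      have hx : star (x : ℂ) = x := Complex.conj_ofReal x
      simp only [Matrix.conjTranspose_add, Matrix.conjTranspose_smul, Matrix.add_mul,
        Matrix.mul_add, Matrix.smul_mul, Matrix.mul_smul, Complex.ofReal_mul, hx, smul_add,
        smul_smul]
      abel
    rw [e] at h
    simp only [Matrix.trace_add, Matrix.trace_smul, Complex.add_re, smul_eq_mul,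
      Complex.re_ofReal_mul, hsymm] at h
    linarith
  have := discrim_le_zero key
  unfold discrim at this
  linarith

lemma re_trace_projection_nonneg {ω P : Matrix n n ℂ} (hω : ω.PosSemidef) (hP : Pᴴ = P)
    (hPP : P * P = P) : 0 ≤ (P * ω).trace.re := by
  have h := re_trace_conjTranspose_mul_mul_nonneg hω P
  rwa [hP, hPP] at h

end TraceForm

/-! ### Fidelity bounded by the probability of passing a supporting projection. -/

section Fidelity

variable {n : Type*} [Fintype n] [DecidableEq n]

lemma re_trace_projection_le_one {ω P : Matrix n n ℂ} (hω : IsState ω) (hP : Pᴴ = P)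
    (hPP : P * P = P) : (P * ω).trace.re ≤ 1 := by
  have h := re_trace_projection_nonneg (P := 1 - P) hω.posSemidef (by simp [hP])
    (by simp [Matrix.sub_mul, Matrix.mul_sub, hPP])
  simp only [Matrix.sub_mul, Matrix.one_mul, Matrix.trace_sub, hω.trace_eq_one, Complex.sub_re,
    Complex.one_re] at h
  linarith

/-- Existence of a generalized inverse of a Hermitian matrix. -/
lemma exists_pseudoinverse {R : Matrix n n ℂ} (hR : R.IsHermitian) :
    ∃ G : Matrix n n ℂ, Gᴴ = G ∧ G * R = R * G ∧ G * (R * R) = R ∧ G * R * G = G := by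
  have hc : ∀ f : ℝ → ℝ, ContinuousOn f (spectrum ℝ R) := fun f =>
    (Matrix.finite_real_spectrum (A := R)).continuousOn f
  have hs : IsSelfAdjoint R := hR
  have hid : cfc (fun x : ℝ => x) R = R := cfc_id' ℝ R
  -- The convention `0⁻¹ = 0` makes this the Moore–Penrose inverse.
  refine ⟨cfc (fun x : ℝ => x⁻¹) R, ?_, ?_, ?_, ?_⟩
  · exact (cfc_predicate (fun x : ℝ => x⁻¹) R : IsSelfAdjoint _)
  · nth_rw 2 [← hid]
    nth_rw 3 [← hid]
    rw [← cfc_mul _ _ R (hc _) (hc _), ← cfc_mul _ _ R (hc _) (hc _)]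
    simp_rw [mul_comm]
  · nth_rw 2 [← hid]
    nth_rw 3 [← hid]
    rw [← cfc_mul _ _ R (hc _) (hc _), ← cfc_mul _ _ R (hc _) (hc _)]
    conv_rhs => rw [← hid]
    refine cfc_congr fun x _ => ?_
    by_cases hx : x = 0
    · simp [hx]
    · field_simp
  · nth_rw 2 [← hid]
    rw [← cfc_mul _ _ R (hc _) (hc _), ← cfc_mul _ _ R (hc _) (hc _)]
    refine cfc_congr fun x _ => ?_
    by_cases hx : x = 0
    · simp [hx]
    · field_simp

/-- If `γ` is supported on the projection `P`, then `F(σ, γ) ≤ Tr[P σ]`. -/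
lemma fidelity_le_re_trace_projection {σ γ P : Matrix n n ℂ} (hσ : σ.PosSemidef)
    (hγ : IsState γ) (hP : Pᴴ = P) (hPP : P * P = P) (hγP : γ * P = γ) :
    fidelity σ γ ≤ (P * σ).trace.re := by
  set S := CFC.sqrt γ with hS
  have hSS : S * S = γ := CFC.sqrt_mul_sqrt_self γ hγ.posSemidef.nonneg
  have hSh : Sᴴ = S := (IsSelfAdjoint.of_nonneg (CFC.sqrt_nonneg γ) : IsSelfAdjoint S)
  have hSP : S * P = S := by
    -- The Gram matrix is (1 - P)γ(1 - P), which vanishes because γP = γ.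
    have h0 : (S * (1 - P))ᴴ * (S * (1 - P)) = 0 := by
      have : (S * (1 - P))ᴴ * (S * (1 - P)) = (1 - P) * (S * S) * (1 - P) := by
        simp [Matrix.conjTranspose_mul, hSh, hP, Matrix.mul_assoc]
      rw [this, hSS, Matrix.mul_assoc, Matrix.mul_sub, Matrix.mul_one, hγP, sub_self,
        Matrix.mul_zero]
    have h1 := Matrix.conjTranspose_mul_self_eq_zero.mp h0
    rw [Matrix.mul_sub, Matrix.mul_one, sub_eq_zero] at h1
    exact h1.symm
  have hPS : P * S = S := by
    have := congrArg Matrix.conjTranspose hSP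
    rwa [Matrix.conjTranspose_mul, hSh, hP] at this
  have hT : (S * σ * S).PosSemidef := by
    have := hσ.mul_mul_conjTranspose_same S
    rwa [hSh] at this
  unfold fidelity
  rw [← hS]
  set R := CFC.sqrt (S * σ * S) with hR
  have hRR : R * R = S * σ * S := CFC.sqrt_mul_sqrt_self _ hT.nonneg
  have hRh : Rᴴ = R := (IsSelfAdjoint.of_nonneg (CFC.sqrt_nonneg _) : IsSelfAdjoint R)
  obtain ⟨G, hGh, hcomm, hGRR, hGRG⟩ := exists_pseudoinverse (R := R) hRh
  -- Pairing `P` with the witness `S * G * S` recovers Tr R, whose square is the fidelity; `P` is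
  -- absorbed by `P * S = S`.
  have e1 : (Pᴴ * (S * G * S) * σ).trace = R.trace := by
    calc (Pᴴ * (S * G * S) * σ).trace = (S * (G * S * σ)).trace := by
          rw [hP, ← Matrix.mul_assoc, ← Matrix.mul_assoc, hPS]; simp only [Matrix.mul_assoc]
      _ = (G * (R * R)).trace := by
          rw [Matrix.trace_mul_comm, hRR]; simp only [Matrix.mul_assoc]
      _ = R.trace := by rw [hGRR]
  have e2 : ((S * G * S)ᴴ * (S * G * S) * σ).trace = (G * R * γ).trace := by
    calc ((S * G * S)ᴴ * (S * G * S) * σ).trace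
        = (S * (G * (S * S) * G * S * σ)).trace := by
          simp only [Matrix.conjTranspose_mul, hSh, hGh, Matrix.mul_assoc]
      _ = (G * (γ * (G * (R * R)))).trace := by
          rw [Matrix.trace_mul_comm, hRR, hSS]; simp only [Matrix.mul_assoc]
      _ = (G * R * γ).trace := by
          rw [hGRR, Matrix.trace_mul_comm, Matrix.mul_assoc, Matrix.trace_mul_comm, ← hcomm]
  have cs := re_trace_cauchy_schwarz hσ P (S * G * S)
  rw [e1, e2, hP, hPP] at cs
  -- `G * R` is the projection onto the range of `R`.
  have hE : (G * R * γ).trace.re ≤ 1 := by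
    apply re_trace_projection_le_one hγ
    · rw [Matrix.conjTranspose_mul, hRh, hGh, hcomm]
    · rw [← Matrix.mul_assoc, hGRG]
  have hp := re_trace_projection_nonneg hσ hP hPP
  nlinarith

end Fidelity

/-! ### Two projections at a constant angle. -/

section TwoProjections

variable {n : Type*} [Fintype n] [DecidableEq n]

/-- Here a and b stand for Re Tr[QPω] and Re Tr[Q(1 - P)ω]. Both bounds carry a factor √q, which
cancels against q = a + b. -/
lemma two_projection_real_bound {k ε p q a b : ℝ} (hk : 1 ≤ k) (hε : 0 ≤ ε)
    (hε' : ε ≤ 1 - 1 / k ^ 2) (hp : 1 - ε ≤ p) (hp' : p ≤ 1) (hq : 0 ≤ q) (hab : q = a + b)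
    (ha : a ^ 2 ≤ 1 / k ^ 2 * q * p) (hb : b ^ 2 ≤ (1 - 1 / k ^ 2) * q * (1 - p)) :
    q ≤ ε + (1 - 2 * ε) / k ^ 2 + 2 * Real.sqrt ((k ^ 2 - 1) * ε * (1 - ε)) / k ^ 2 := by
  have hk0 : 0 < k := by linarith
  set c := 1 / k with hc
  have hc0 : 0 < c := by positivity
  have hc2 : 1 / k ^ 2 = c ^ 2 := by rw [hc]; ring
  rw [hc2] at ha hb hε'
  have hs0 : 0 ≤ 1 - c ^ 2 := by linarith
  have h1ε : 0 ≤ 1 - ε := by nlinarith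
  set s := Real.sqrt (1 - c ^ 2) with hs
  set x := Real.sqrt p with hx
  set y := Real.sqrt (1 - p) with hy
  set x₀ := Real.sqrt (1 - ε) with hx₀
  set y₀ := Real.sqrt ε with hy₀
  set r := Real.sqrt q with hr
  have s2 : s ^ 2 = 1 - c ^ 2 := Real.sq_sqrt hs0
  have x2 : x ^ 2 = p := Real.sq_sqrt (by linarith)
  have y2 : y ^ 2 = 1 - p := Real.sq_sqrt (by linarith)
  have x02 : x₀ ^ 2 = 1 - ε := Real.sq_sqrt h1ε
  have y02 : y₀ ^ 2 = ε := Real.sq_sqrt hε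
  have r2 : r ^ 2 = q := Real.sq_sqrt hq
  have hs' : 0 ≤ s := Real.sqrt_nonneg _
  have hx' : 0 ≤ x := Real.sqrt_nonneg _
  have hy' : 0 ≤ y := Real.sqrt_nonneg _
  have hx0' : 0 ≤ x₀ := Real.sqrt_nonneg _
  have hy0' : 0 ≤ y₀ := Real.sqrt_nonneg _
  have hr' : 0 ≤ r := Real.sqrt_nonneg _
  have ha' : a ≤ c * r * x :=
    abs_le_of_sq_le_sq' (by rw [mul_pow, mul_pow, r2, x2]; exact ha) (by positivity) |>.2
  have hb' : b ≤ s * r * y :=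
    abs_le_of_sq_le_sq' (by rw [mul_pow, mul_pow, r2, y2, s2]; exact hb) (by positivity) |>.2
  have hxx : x₀ ≤ x := Real.sqrt_le_sqrt hp
  have hyy : y ≤ y₀ := Real.sqrt_le_sqrt (by linarith)
  have hcx : c ≤ x₀ := Real.le_sqrt_of_sq_le (by linarith)
  have hys : y₀ ≤ s := Real.sqrt_le_sqrt hε'
  -- Since x² - x₀² = y₀² - y², half this common value lies between c(x - x₀) and s(y₀ - y), because
  -- c ≤ x₀ ≤ x and y ≤ y₀ ≤ s.
  have hmono : c * x + s * y ≤ c * x₀ + s * y₀ := by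
    have h1 : c * (x - x₀) ≤ (x + x₀) / 2 * (x - x₀) :=
      mul_le_mul_of_nonneg_right (by linarith) (by linarith)
    have h2 : (y + y₀) / 2 * (y₀ - y) ≤ s * (y₀ - y) :=
      mul_le_mul_of_nonneg_right (by linarith) (by linarith)
    nlinarith
  have hrle : r ≤ c * x₀ + s * y₀ := by
    refine le_trans ?_ hmono
    rcases hr'.eq_or_lt with h | h
    · rw [← h]; positivity
    · refine le_of_mul_le_mul_left ?_ h
      nlinarith
  have hqle : q ≤ (c * x₀ + s * y₀) ^ 2 := by
    rw [← r2]; exact pow_le_pow_left₀ hr' hrle 2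
  have hsk : s * k = Real.sqrt (k ^ 2 - 1) := by
    rw [hs, ← Real.sqrt_sq hk0.le, ← Real.sqrt_mul hs0, Real.sqrt_sq hk0.le]
    congr 1
    rw [hc]; field_simp
  have hroot : Real.sqrt ((k ^ 2 - 1) * ε * (1 - ε)) = s * k * y₀ * x₀ := by
    have : 0 ≤ k ^ 2 - 1 := by nlinarith
    rw [hsk, Real.sqrt_mul (by positivity), Real.sqrt_mul this]
  have hfin : (c * x₀ + s * y₀) ^ 2 =
      ε + (1 - 2 * ε) / k ^ 2 + 2 * (s * k * y₀ * x₀) / k ^ 2 := by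
    have h1 : (c * x₀ + s * y₀) ^ 2 =
        c ^ 2 * (1 - ε) + (1 - c ^ 2) * ε + 2 * c * s * x₀ * y₀ := by
      rw [← s2, ← x02, ← y02]; ring
    rw [h1, hc]; field_simp; ring
  rw [hroot, ← hfin]
  exact hqle

/-- A state passing the test `P` with probability at least `1 - ε` passes a test `Q` with
`Q P Q = k⁻² Q` with probability at most `ς(ε, k)`. -/
lemma re_trace_le_varsigma {ω P Q : Matrix n n ℂ} {k : ℕ} (hk : 1 ≤ k) {ε : ℝ}
    (hε : ε ∈ Set.Icc (0 : ℝ) (1 - 1 / (k : ℝ) ^ 2)) (hω : IsState ω)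
    (hP : Pᴴ = P) (hPP : P * P = P) (hQ : Qᴴ = Q) (hQQ : Q * Q = Q)
    (hQPQ : Q * P * Q = ((1 / (k : ℝ) ^ 2 : ℝ) : ℂ) • Q) (h : 1 - ε ≤ (P * ω).trace.re) :
    (Q * ω).trace.re ≤ varsigma ε k := by
  have cs₁ := re_trace_cauchy_schwarz hω.posSemidef (P * Q) P
  have cs₂ := re_trace_cauchy_schwarz hω.posSemidef ((1 - P) * Q) (1 - P)
  have hP' : (1 - P)ᴴ = 1 - P := by simp [hP]
  have hPP' : (1 - P) * (1 - P) = 1 - P := by simp [Matrix.sub_mul, Matrix.mul_sub, hPP]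
  have e₁ : (P * Q)ᴴ * P = Q * P := by
    rw [Matrix.conjTranspose_mul, hP, hQ, Matrix.mul_assoc, hPP]
  have e₂ : (P * Q)ᴴ * (P * Q) = ((1 / (k : ℝ) ^ 2 : ℝ) : ℂ) • Q := by
    rw [← Matrix.mul_assoc, e₁, hQPQ]
  have e₃ : ((1 - P) * Q)ᴴ * (1 - P) = Q * (1 - P) := by
    rw [Matrix.conjTranspose_mul, hP', hQ, Matrix.mul_assoc, hPP']
  have e₄ : ((1 - P) * Q)ᴴ * ((1 - P) * Q) = ((1 - 1 / (k : ℝ) ^ 2 : ℝ) : ℂ) • Q := by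
    rw [← Matrix.mul_assoc, e₃, Matrix.mul_sub, Matrix.sub_mul, hQPQ, Matrix.mul_one, hQQ,
      Complex.ofReal_sub, sub_smul, Complex.ofReal_one, one_smul]
  rw [e₁, e₂, hP, hPP] at cs₁
  rw [e₃, e₄, hP', hPP'] at cs₂
  simp only [Matrix.smul_mul, Matrix.trace_smul, smul_eq_mul, Complex.re_ofReal_mul] at cs₁ cs₂
  have hsub : ((1 - P) * ω).trace.re = 1 - (P * ω).trace.re := by
    simp [Matrix.sub_mul, Matrix.trace_sub, hω.trace_eq_one]
  rw [hsub] at cs₂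
  refine two_projection_real_bound (by exact_mod_cast hk) hε.1 hε.2 h
    (re_trace_projection_le_one hω hP hPP) (re_trace_projection_nonneg hω.posSemidef hQ hQQ)
    ?_ cs₁ cs₂
  rw [← Complex.add_re, ← Matrix.trace_add, ← Matrix.add_mul, ← Matrix.mul_add]
  simp

end TwoProjections

/-! ### Operators tensored with the identity, and partial traces. -/

section PartialTrace

variable {α β η κ : Type*}

/-- `M_{AB} ⊗ I_E`. -/
def tensorOneE (η : Type*) [DecidableEq η] (M : Matrix (α × β) κ ℂ) :
    Matrix (α × β × η) (κ × η) ℂ :=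
  Matrix.of fun p q => if p.2.2 = q.2 then M (p.1, p.2.1) q.1 else 0

/-- `M_{AE} ⊗ I_B`. -/
def tensorOneB (β : Type*) [DecidableEq β] (M : Matrix (α × η) κ ℂ) :
    Matrix (α × β × η) (κ × β) ℂ :=
  Matrix.of fun p q => if p.2.1 = q.2 then M (p.1, p.2.2) q.1 else 0

/-- Exchanging B and E carries results on `tensorOneE` over to `tensorOneB`. -/
lemma tensorOneB_eq_submatrix [DecidableEq β] (M : Matrix (α × η) κ ℂ) :
    tensorOneB β M =
      (tensorOneE β M).submatrix ((Equiv.refl α).prodCongr (Equiv.prodComm β η))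
        (Equiv.refl _) := rfl

lemma traceB_eq_traceE [Fintype β] (ω : Matrix (α × β × η) (α × β × η) ℂ) :
    traceB ω = traceE (ω.submatrix ((Equiv.refl α).prodCongr (Equiv.prodComm η β))
      ((Equiv.refl α).prodCongr (Equiv.prodComm η β))) := rfl

variable [Fintype α] [Fintype β] [Fintype η]

lemma conjTranspose_tensorOneE_mul_self [DecidableEq η] [DecidableEq κ]
    {M : Matrix (α × β) κ ℂ} (hM : Mᴴ * M = 1) :
    (tensorOneE η M)ᴴ * tensorOneE η M = 1 := by
  ext ⟨z, e⟩ ⟨w, f⟩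
  have h := congrFun (congrFun hM z) w
  simp only [Matrix.mul_apply, Matrix.conjTranspose_apply, Fintype.sum_prod_type,
    Matrix.one_apply] at h
  by_cases hef : e = f
  · subst hef
    simpa [Matrix.mul_apply, tensorOneE, Fintype.sum_prod_type, Matrix.one_apply, apply_ite]
      using h
  · simp [Matrix.mul_apply, tensorOneE, Fintype.sum_prod_type, apply_ite, hef, Ne.symm hef]

lemma conjTranspose_tensorOneB_mul_self [DecidableEq β] [DecidableEq κ]
    {M : Matrix (α × η) κ ℂ} (hM : Mᴴ * M = 1) :
    (tensorOneB β M)ᴴ * tensorOneB β M = 1 := by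
  rw [tensorOneB_eq_submatrix, Matrix.conjTranspose_submatrix, Matrix.submatrix_mul_equiv,
    conjTranspose_tensorOneE_mul_self hM, Matrix.submatrix_one_equiv]

/-- The operator `M_{AE}† M_{AB}`. -/
lemma conjTranspose_tensorOneB_mul_tensorOneE_apply {κ' : Type*} [DecidableEq β] [DecidableEq η]
    (M : Matrix (α × η) κ ℂ) (N : Matrix (α × β) κ' ℂ) (z : κ) (b : β) (w : κ') (e : η) :
    ((tensorOneB β M)ᴴ * tensorOneE η N) (z, b) (w, e) = ∑ a, star (M (a, e) z) * N (a, b) w := by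
  simp [Matrix.mul_apply, tensorOneB, tensorOneE, Fintype.sum_prod_type, apply_ite]

variable [Fintype κ]

lemma trace_tensorOneE [DecidableEq η] (M : Matrix (α × β) κ ℂ)
    (ω : Matrix (α × β × η) (α × β × η) ℂ) :
    (tensorOneE η M * (tensorOneE η M)ᴴ * ω).trace = (M * Mᴴ * traceE ω).trace := by
  have h : ∀ a b e a' b' e', (tensorOneE η M * (tensorOneE η M)ᴴ) (a, b, e) (a', b', e') =
      if e = e' then (M * Mᴴ) (a, b) (a', b') else 0 := by
    intro a b e a' b' e'
    by_cases hef : e = e'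
    · subst hef
      simp [Matrix.mul_apply, tensorOneE, Fintype.sum_prod_type, apply_ite]
    · simp [Matrix.mul_apply, tensorOneE, Fintype.sum_prod_type, apply_ite, hef]
  simp only [Matrix.trace, Matrix.diag_apply]
  simp only [Matrix.mul_apply (M := _ * _), Fintype.sum_prod_type, h, traceE, Matrix.of_apply,
    ite_mul, zero_mul, Finset.sum_ite_eq, Finset.mem_univ, if_true, Finset.mul_sum]
  refine Finset.sum_congr rfl fun a _ => Finset.sum_congr rfl fun b _ => ?_
  rw [Finset.sum_comm]
  refine Finset.sum_congr rfl fun a' _ => ?_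
  rw [Finset.sum_comm]

lemma trace_submatrix_equiv {m l : Type*} [Fintype m] [Fintype l] (e : m ≃ l)
    (M : Matrix l l ℂ) : (M.submatrix e e).trace = M.trace :=
  Equiv.sum_comp e fun i => M i i

lemma trace_tensorOneB [DecidableEq β] (M : Matrix (α × η) κ ℂ)
    (ω : Matrix (α × β × η) (α × β × η) ℂ) :
    (tensorOneB β M * (tensorOneB β M)ᴴ * ω).trace = (M * Mᴴ * traceB ω).trace := by
  rw [traceB_eq_traceE, ← trace_tensorOneE,
    ← trace_submatrix_equiv ((Equiv.refl α).prodCongr (Equiv.prodComm β η)),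
    ← Matrix.submatrix_mul_equiv _ _ _ ((Equiv.refl α).prodCongr (Equiv.prodComm β η)) _,
    ← Matrix.submatrix_mul_equiv _ _ _ (Equiv.refl _) _, ← Matrix.conjTranspose_submatrix,
    ← tensorOneB_eq_submatrix]
  rfl

end PartialTrace

/-! ### The shield isometry and the overlap of the two tests. -/

section Twist

variable {k : ℕ} {s t : Type*} [Fintype s] [DecidableEq s] [Fintype t] [DecidableEq t]

lemma inv_sqrt_mul_inv_sqrt (k : ℕ) :
    ((Real.sqrt k : ℝ) : ℂ)⁻¹ * ((Real.sqrt k : ℝ) : ℂ)⁻¹ = (k : ℂ)⁻¹ := by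
  rw [← mul_inv, ← Complex.ofReal_mul, Real.mul_self_sqrt (Nat.cast_nonneg k),
    Complex.ofReal_natCast]

lemma unitary_sum_mul_star {n : Type*} [Fintype n] [DecidableEq n] (u : Matrix.unitaryGroup n ℂ)
    (p q : n) : ∑ w, u.1 p w * star (u.1 q w) = if p = q then 1 else 0 := by
  rw [← Matrix.one_apply, ← Matrix.mem_unitaryGroup_iff.mp u.2, Matrix.mul_apply]
  rfl

lemma unitary_sum_star_mul {n : Type*} [Fintype n] [DecidableEq n] (u : Matrix.unitaryGroup n ℂ)
    (p q : n) : ∑ w, star (u.1 w p) * u.1 w q = if p = q then 1 else 0 := by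
  rw [← Matrix.one_apply, ← Matrix.mem_unitaryGroup_iff'.mp u.2, Matrix.mul_apply]
  rfl

/-- The isometry `φ ↦ V (|Φ^k⟩ ⊗ φ)` from the shield systems to all systems. -/
noncomputable def shieldIsometry (U : Fin k → Matrix.unitaryGroup (s × t) ℂ) :
    Matrix ((Fin k × s) × (Fin k × t)) (s × t) ℂ :=
  Matrix.of fun p z =>
    maxEntVec k (p.1.1, p.2.1) * (U p.1.1 : Matrix (s × t) (s × t) ℂ) (p.1.2, p.2.2) z

/-- Φᵏ has rank one, so conjugation by V factors through the shield; τ = 1 then gives the test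
itself. -/
lemma privateState_eq (U : Fin k → Matrix.unitaryGroup (s × t) ℂ)
    (τ : Matrix (s × t) (s × t) ℂ) :
    privateState U τ = shieldIsometry U * τ * (shieldIsometry U)ᴴ := by
  set Φ : Matrix ((Fin k × Fin k) × (s × t)) (s × t) ℂ :=
    Matrix.of fun p z => maxEntVec k p.1 * (1 : Matrix (s × t) (s × t) ℂ) p.2 z with hΦ
  have h1 : maxEnt k ⊗ₖ τ = Φ * τ * Φᴴ := by
    ext ⟨p, z⟩ ⟨q, w⟩
    have hL : (Φ * τ) (p, z) = fun y => maxEntVec k p * τ z y := by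
      ext y
      simp [hΦ, Matrix.mul_apply, Matrix.one_apply]
    rw [Matrix.mul_apply, hL]
    simp [hΦ, Matrix.one_apply, maxEnt, Matrix.vecMulVec_apply, apply_ite]
    ring
  have h2 : shieldIsometry U =
      (twist U * Φ).submatrix (Equiv.prodProdProdComm (Fin k) (Fin k) s t).symm id := by
    ext ⟨⟨i, x⟩, ⟨j, y⟩⟩ z
    simp [shieldIsometry, twist, hΦ, Matrix.mul_apply, Matrix.sum_apply, Matrix.one_apply,
      Matrix.single_apply, Fintype.sum_prod_type, Matrix.kroneckerMap_apply,
      ite_and, mul_comm]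
  unfold privateState regroup
  have h3 : twist U * (Φ * τ * Φᴴ) * (twist U)ᴴ = twist U * Φ * τ * (twist U * Φ)ᴴ := by
    simp only [Matrix.conjTranspose_mul, Matrix.mul_assoc]
  rw [h1, h2, h3]
  rfl

lemma privacyTest_eq (U : Fin k → Matrix.unitaryGroup (s × t) ℂ) :
    privacyTest U = shieldIsometry U * (shieldIsometry U)ᴴ := by
  have h := privateState_eq U 1
  rwa [Matrix.mul_one] at h

lemma conjTranspose_shieldIsometry_mul_self (hk : 1 ≤ k)
    (U : Fin k → Matrix.unitaryGroup (s × t) ℂ) :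
    (shieldIsometry U)ᴴ * shieldIsometry U = 1 := by
  ext z w
  have h : ∀ i, ∑ x, ∑ y, star ((U i).1 (x, y) z) * (U i).1 (x, y) w =
      (1 : Matrix (s × t) (s × t) ℂ) z w := by
    intro i
    rw [Matrix.one_apply, ← unitary_sum_star_mul (U i), Fintype.sum_prod_type]
  simp [Matrix.mul_apply, shieldIsometry, maxEntVec, Fintype.sum_prod_type]
  have hk' : (k : ℂ) ≠ 0 := by exact_mod_cast (by omega : k ≠ 0)
  simp_rw [mul_mul_mul_comm, inv_sqrt_mul_inv_sqrt, ← Finset.mul_sum]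
  simp only [Complex.star_def] at h
  simp [h, hk']

lemma isState_privateState (hk : 1 ≤ k) (U : Fin k → Matrix.unitaryGroup (s × t) ℂ)
    {τ : Matrix (s × t) (s × t) ℂ} (hτ : IsState τ) : IsState (privateState U τ) := by
  rw [privateState_eq]
  refine ⟨hτ.posSemidef.mul_mul_conjTranspose_same _, ?_⟩
  rw [Matrix.trace_mul_comm, ← Matrix.mul_assoc, conjTranspose_shieldIsometry_mul_self hk,
    Matrix.one_mul, hτ.trace_eq_one]

/-- Summing over `w` uses orthonormal rows and forces equal `x` and `y` indices; the remaining sum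
over `x` and `v` is an inner product of columns. -/
lemma sum_partial_inner_mul_star (u : Matrix.unitaryGroup (s × t) ℂ) (z z' : s × t) (y y' : t) :
    ∑ v, ∑ w, (∑ x, star (u.1 (x, v) z) * u.1 (x, y) w) *
      star (∑ x, star (u.1 (x, v) z') * u.1 (x, y') w) =
    if z = z' ∧ y = y' then 1 else 0 := by
  have h : ∀ v, ∑ w, (∑ x, star (u.1 (x, v) z) * u.1 (x, y) w) *
      star (∑ x, star (u.1 (x, v) z') * u.1 (x, y') w) =
      if y = y' then ∑ x, star (u.1 (x, v) z) * u.1 (x, v) z' else 0 := by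
    intro v
    calc _ = ∑ x, ∑ x', star (u.1 (x, v) z) * u.1 (x', v) z' *
          ∑ w, u.1 (x, y) w * star (u.1 (x', y') w) := by
          simp_rw [star_sum, Finset.sum_mul_sum, Finset.mul_sum]
          rw [Finset.sum_comm]
          refine Finset.sum_congr rfl fun x _ => ?_
          rw [Finset.sum_comm]
          refine Finset.sum_congr rfl fun x' _ => Finset.sum_congr rfl fun w _ => ?_
          rw [star_mul', star_star]
          ring
      _ = _ := by
          simp_rw [unitary_sum_mul_star, Prod.mk.injEq]
          by_cases hy : y = y' <;> simp [hy]
  simp_rw [h]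
  by_cases hy : y = y'
  · have h2 := unitary_sum_star_mul u z z'
    rw [Fintype.sum_prod_type, Finset.sum_comm] at h2
    simp [hy, ← h2]
  · simp [hy]

/-- The range of the test on `A E` meets the range of the test on `A B` at the constant angle
`arccos (1 / k)`. -/
lemma shieldIsometry_overlap (U : Fin k → Matrix.unitaryGroup (s × t) ℂ) :
    ((tensorOneB (Fin k × t) (shieldIsometry U))ᴴ *
        tensorOneE (Fin k × t) (shieldIsometry U)) *
      ((tensorOneB (Fin k × t) (shieldIsometry U))ᴴ *
        tensorOneE (Fin k × t) (shieldIsometry U))ᴴ =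
    ((1 / (k : ℝ) ^ 2 : ℝ) : ℂ) • 1 := by
  -- Both tests tie their key index to Alice's, so only j = l survives; 1/k is the product of two
  -- amplitudes 1/√k.
  have hK : ∀ z j y w l v, ((tensorOneB (Fin k × t) (shieldIsometry U))ᴴ *
      tensorOneE (Fin k × t) (shieldIsometry U)) (z, (j, y)) (w, (l, v)) =
      if j = l then (1 / k : ℂ) * ∑ x, star ((U j).1 (x, v) z) * (U j).1 (x, y) w else 0 := by
    intro z j y w l v
    rw [conjTranspose_tensorOneB_mul_tensorOneE_apply]
    by_cases hjl : j = l
    · subst hjl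
      simp [shieldIsometry, maxEntVec, Fintype.sum_prod_type, Finset.mul_sum,
        mul_mul_mul_comm, inv_sqrt_mul_inv_sqrt]
    · simp [shieldIsometry, maxEntVec, Fintype.sum_prod_type, hjl]
  ext ⟨z, ⟨j, y⟩⟩ ⟨z', ⟨j', y'⟩⟩
  rw [Matrix.mul_apply, Fintype.sum_prod_type]
  simp_rw [Fintype.sum_prod_type (α₁ := Fin k), Matrix.conjTranspose_apply, hK]
  by_cases hj : j = j'
  · subst hj
    simp only [ite_mul, zero_mul, Finset.sum_ite_irrel, Finset.sum_const_zero, Finset.sum_ite_eq,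
      Finset.mem_univ, if_true]
    have h := sum_partial_inner_mul_star (U j) z z' y y'
    rw [Finset.sum_comm] at h
    simp_rw [star_mul', mul_mul_mul_comm, ← Finset.mul_sum, h]
    rw [Matrix.smul_apply, Matrix.one_apply]
    simp only [Prod.mk.injEq, true_and]
    simp [pow_two]
  · simp [hj, Ne.symm hj]

end Twist

end PrivacyTest

theorem lemma2 {s t : Type*} [Fintype s] [DecidableEq s] [Fintype t] [DecidableEq t]
    (k : ℕ) (hk : 1 ≤ k) (ε : ℝ) (hε : ε ∈ Set.Icc (0 : ℝ) (1 - 1 / (k : ℝ) ^ 2))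
    (σ γ : Matrix ((Fin k × s) × (Fin k × t)) ((Fin k × s) × (Fin k × t)) ℂ)
    (hσ : PrivacyTest.IsState σ)
    (U : Fin k → Matrix.unitaryGroup (s × t) ℂ)
    (τ : Matrix (s × t) (s × t) ℂ) (hτ : PrivacyTest.IsState τ)
    (hγ : γ = PrivacyTest.privateState U τ)
    (hF : 1 - ε ≤ PrivacyTest.fidelity σ γ)
    (ω : Matrix ((Fin k × s) × (Fin k × t)) ((Fin k × s) × (Fin k × t)) ℂ)
    (hω : ω ∈ PrivacyTest.freeStates σ) :
    (Matrix.trace (PrivacyTest.privacyTest U * ω)).re ≤ PrivacyTest.varsigma ε k := by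
  open PrivacyTest in
  obtain ⟨Ω, ⟨hΩ, rfl⟩, rfl⟩ := hω
  set J := shieldIsometry U with hJ
  have hJJ : Jᴴ * J = 1 := conjTranspose_shieldIsometry_mul_self hk U
  have hproj : ∀ {m l : Type _} [Fintype m] [Fintype l] [DecidableEq l] (K : Matrix m l ℂ),
      Kᴴ * K = 1 → (K * Kᴴ)ᴴ = K * Kᴴ ∧ K * Kᴴ * (K * Kᴴ) = K * Kᴴ := by
    intro m l _ _ _ K hK
    refine ⟨by simp, ?_⟩
    rw [← Matrix.mul_assoc, Matrix.mul_assoc K, hK, Matrix.mul_one]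
  obtain ⟨hJs, hJp⟩ := hproj J hJJ
  obtain ⟨hP, hPP⟩ := hproj _ (conjTranspose_tensorOneE_mul_self (η := Fin k × t) hJJ)
  obtain ⟨hQ, hQQ⟩ := hproj _ (conjTranspose_tensorOneB_mul_self (β := Fin k × t) hJJ)
  rw [privacyTest_eq, ← hJ, ← trace_tensorOneB]
  set TB := tensorOneB (Fin k × t) J with hTB
  set TE := tensorOneE (Fin k × t) J with hTE
  refine re_trace_le_varsigma hk hε hΩ hP hPP hQ hQQ ?_ ?_
  · have h := shieldIsometry_overlap U
    rw [← hJ, ← hTB, ← hTE] at h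
    calc _ = TB * ((TBᴴ * TE) * (TBᴴ * TE)ᴴ) * TBᴴ := by
          simp only [Matrix.conjTranspose_mul, Matrix.conjTranspose_conjTranspose,
            Matrix.mul_assoc]
      _ = _ := by rw [h, Matrix.mul_smul, Matrix.mul_one, Matrix.smul_mul]
  · rw [hTE, trace_tensorOneE]
    refine hF.trans ?_
    refine fidelity_le_re_trace_projection hσ.posSemidef ?_ hJs hJp ?_
    · rw [hγ]; exact isState_privateState hk U hτ
    · rw [hγ, privateState_eq, ← hJ, ← Matrix.mul_assoc, Matrix.mul_assoc (J * τ), hJJ,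
        Matrix.mul_one]
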